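/- Say that an ordinal $\delta>0$ is *rank-Berkeley* if for all ordinals $\alpha\ge\delta$ and $\eta<\delta$ there is an elementary embedding $k:V_\alpha\to V_\alpha$ with $\mathrm{crit}(k)>\eta$ and $\kappa_\omega(k)=\delta$. Here $\mathrm{crit}(k)$ is the least ordinal moved by $k$, and $\kappa_\omega(k)=\sup_{n<\omega}\kappa_n$ where $\kappa_0=\mathrm{crit}(k)$ and $\kappa_{n+1}=k(\kappa_n)$; the same notation is used for $j:V\to V$. $\mathsf{ZF}(j)$ is $\mathsf{ZF}$ (without choice) in the language with symbols $\in$ and $j$, with Separation and Collection for all formulas of this language. **Theorem.** Let $(V,\in,j)$ be a model of $\mathsf{ZF}(j)$ in which $j:V\to V$ is a non-identity map that is elementary for the language $\{\in\}$. All of the following is interpreted in this model. Let $\kappa=\mathrm{crit}(j)$ and $\lambda=\kappa_\omega(j)$, and suppose that the least rank-Berkeley ordinal $\delta$ satisfies $\delta<\lambda$. Let $\mu_j=\{X\subseteq\kappa:\kappa\in j(X)\}$ be the measure over $\kappa$ derived from $j$. Then $\delta<\kappa$, and there is $\kappa'<\delta$ such that the set of all $\gamma<\kappa$ with $$(V_\gamma,V_{\gamma+1})\models\text{``}\kappa'\text{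 is a Reinhardt cardinal''}$$ belongs to $\mu_j$. The displayed statement means that the structure with sets the elements of $V_\gamma$ and classes the elements of $V_{\gamma+1}$ is a model of second-order $\mathsf{ZF}$ (Separation and Collection for all classes), and that some class $k\in V_{\gamma+1}$ is an elementary embedding $k:(V_\gamma,\in)\to(V_\gamma,\in)$ with $\mathrm{crit}(k)=\kappa'$. -/

import Mathlib

universe u

namespace Reinhardt

/-! ## First-order languages and the axioms of set theory -/

/-- The only non-logical symbol of the language of set theory: binary membership. -/
inductive MemRel : ℕ → Type
  | mem : MemRel 2

/-- One unary function symbol, for the embedding. -/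
inductive EmbFun : ℕ → Type
  | emb : EmbFun 1

/-- The language of set theory. -/
def LSet : FirstOrder.Language.{0, 0} := ⟨fun _ => Empty, MemRel⟩

/-- The language of set theory with an additional symbol for a function `j : V → V`. -/
def LSetJ : FirstOrder.Language.{0, 0} := ⟨EmbFun, MemRel⟩

/-- `(M, E)` as a structure for the language of set theory. -/
@[reducible] def setStr {M : Type u} (E : M → M → Prop) : LSet.Structure M where
  funMap := fun f _ => Empty.elim f
  RelMap := fun r => match r with
    | MemRel.mem => fun v => E (v 0) (v 1)

/-- `(M, E, j)` as a structure for the expanded language. -/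
@[reducible] def setJStr {M : Type u} (E : M → M → Prop) (j : M → M) : LSetJ.Structure M where
  funMap := fun f => match f with
    | EmbFun.emb => fun v => j (v 0)
  RelMap := fun r => match r with
    | MemRel.mem => fun v => E (v 0) (v 1)

/-- The Zermelo-Fraenkel axioms (without choice) for a membership relation `E` on `N`, where
Separation is required for the unary predicates in `Cls₁` and Collection for the binary
relations in `Cls₂`. -/
structure ZFAxioms {N : Type u} (E : N → N → Prop)
    (Cls₁ : (N → Prop) → Prop) (Cls₂ : (N → N → Prop) → Prop) : Prop where
  extensionality : ∀ x y, (∀ z, E z x ↔ E z y) → x = y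
  foundation : ∀ x, (∃ y, E y x) → ∃ y, E y x ∧ ∀ z, E z y → ¬ E z x
  pairing : ∀ x y, ∃ z, ∀ t, E t z ↔ t = x ∨ t = y
  union : ∀ x, ∃ z, ∀ t, E t z ↔ ∃ y, E y x ∧ E t y
  powerset : ∀ x, ∃ z, ∀ t, E t z ↔ ∀ s, E s t → E s x
  infinity : ∃ x, (∃ e, (∀ z, ¬ E z e) ∧ E e x) ∧
    ∀ y, E y x → ∃ z, (∀ t, E t z ↔ E t y ∨ t = y) ∧ E z x
  separation : ∀ P, Cls₁ P → ∀ a, ∃ b, ∀ x, E x b ↔ E x a ∧ P x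
  collection : ∀ R, Cls₂ R → ∀ a, (∀ x, E x a → ∃ y, R x y) →
    ∃ b, ∀ x, E x a → ∃ y, E y b ∧ R x y

/-- `(M, E, j)` is a model of `ZF(j)`: Separation and Collection hold for all formulas with
parameters of the language with symbols for membership and `j`. The parameters of the formula
`φ` are the values of the assignment `v`. -/
def ModelsZFJ {M : Type u} (E : M → M → Prop) (j : M → M) : Prop :=
  ZFAxioms E
    (fun P => ∃ (φ : LSetJ.Formula ℕ) (v : ℕ → M),
      ∀ x, P x ↔ @FirstOrder.Language.Formula.Realize LSetJ M (setJStr E j) ℕ φ (Function.update v 0 x))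
    (fun R => ∃ (φ : LSetJ.Formula ℕ) (v : ℕ → M),
      ∀ x y, R x y ↔ @FirstOrder.Language.Formula.Realize LSetJ M (setJStr E j) ℕ φ
        (Function.update (Function.update v 0 x) 1 y))

/-- `j : (M, E) → (M, E)` is fully elementary for the language of set theory. -/
def IsElementary {M : Type u} (E : M → M → Prop) (j : M → M) : Prop :=
  ∀ (φ : LSet.Formula ℕ) (v : ℕ → M),
    @FirstOrder.Language.Formula.Realize LSet M (setStr E) ℕ φ v ↔
      @FirstOrder.Language.Formula.Realize LSet M (setStr E) ℕ φ (fun i => j (v i))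

/-! ## Set-theoretic notions, as computed in a model `(M, E)`

All quantifiers range over the model, so each of these says that `(M, E)` satisfies the
first-order formula that defines the notion. -/

section Notions

variable {M : Type u} (E : M → M → Prop)

/-- `x ⊆ y` -/
def IsSub (x y : M) : Prop := ∀ z, E z x → E z y

/-- `y = x ∪ {x}` -/
def IsSucc (x y : M) : Prop := ∀ z, E z y ↔ E z x ∨ z = x

/-- `x` is the numeral `n` (for the finitely many standard numerals used as tags below). -/
def IsNum : ℕ → M → Prop
  | 0, x => ∀ z, ¬ E z x
  | n + 1, x => ∃ y, IsNum n y ∧ IsSucc E y x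

/-- `p` is the Kuratowski pair `(x, y) = {{x}, {x, y}}` -/
def IsOPair (p x y : M) : Prop :=
  ∀ z, E z p ↔ (∀ t, E t z ↔ t = x) ∨ (∀ t, E t z ↔ t = x ∨ t = y)

/-- `(x, y) ∈ f`; if `f` is a function, `f(x) = y` -/
def App (f x y : M) : Prop := ∃ p, IsOPair E p x y ∧ E p f

/-- `f` is a function with domain `a` -/
def IsFunOn (f a : M) : Prop :=
  (∀ p, E p f → ∃ x y, E x a ∧ IsOPair E p x y) ∧ ∀ x, E x a → ∃! y, App E f x y

/-- `f : a → b` -/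
def IsMap (f a b : M) : Prop := IsFunOn E f a ∧ ∀ x y, App E f x y → E y b

/-- `x` is an ordinal: transitive and linearly ordered by membership -/
def IsOrd (x : M) : Prop :=
  (∀ y, E y x → IsSub E y x) ∧ ∀ y z, E y x → E z x → E y z ∨ y = z ∨ E z y

/-- `w = ω`, the intersection of all inductive sets -/
def IsOmega (w : M) : Prop :=
  ∀ x, E x w ↔ ∀ I, (∀ e, IsNum E 0 e → E e I) →
    (∀ y z, E y I → IsSucc E y z → E z I) → E x I

/-- `x = V_α`, by the recursion `V_α = ⋃_{β < α} 𝒫(V_β)`; the function `f` is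
`β ↦ V_β` for `β < α`. -/
def IsV (α x : M) : Prop :=
  IsOrd E α ∧ ∃ f, IsFunOn E f α ∧
    (∀ β z, App E f β z → ∀ y, E y z ↔ ∃ γ u, E γ β ∧ App E f γ u ∧ IsSub E y u) ∧
    ∀ y, E y x ↔ ∃ γ u, E γ α ∧ App E f γ u ∧ IsSub E y u

/-! ### Coded formulas and satisfaction in set structures `(S, ∈)` -/

/-- `p = (n, (a, b))` -/
def IsCode₂ (n : ℕ) (a b p : M) : Prop :=
  ∃ t q, IsNum E n t ∧ IsOPair E q a b ∧ IsOPair E p t q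

/-- `p` codes `v_i ∈ v_k` -/
def CMem (i k p : M) : Prop := IsCode₂ E 0 i k p

/-- `p` codes `v_i = v_k` -/
def CEq (i k p : M) : Prop := IsCode₂ E 1 i k p

/-- `p` codes the negation of `a` -/
def CNot (a p : M) : Prop := ∃ t, IsNum E 2 t ∧ IsOPair E p t a

/-- `p` codes the conjunction of `a` and `b` -/
def CAnd (a b p : M) : Prop := IsCode₂ E 3 a b p

/-- `p` codes `∃ v_i, a` -/
def CEx (i a p : M) : Prop := IsCode₂ E 4 i a p

/-- `p` is (the code of) a formula of the language of set theory: it belongs to every set that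
contains the atomic formulas and is closed under negation, conjunction and quantification. -/
def IsFml (p : M) : Prop :=
  ∀ w X, IsOmega E w →
    (∀ i k q, E i w → E k w → CMem E i k q ∨ CEq E i k q → E q X) →
    (∀ a q, E a X → CNot E a q → E q X) →
    (∀ a b q, E a X → E b X → CAnd E a b q → E q X) →
    (∀ i a q, E i w → E a X → CEx E i a q → E q X) → E p X

/-- `s' = s[i ↦ a]`, for functions `s, s'` with domain `w` -/
def IsUpd (w s i a s' : M) : Prop :=
  App E s' i a ∧ ∀ n x, E n w → n ≠ i → (App E s' n x ↔ App E s n x)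

/-- `T` is a satisfaction relation for the structure `(S, ∈)`: as far as pairs `(p, s)` of a
formula `p` and an assignment `s : ω → S` are concerned, it obeys Tarski's clauses. -/
def IsSatRel (S T : M) : Prop :=
  ∀ w, IsOmega E w → ∀ s, IsMap E s w S →
    (∀ i k p x y, E i w → E k w → App E s i x → App E s k y →
      (CMem E i k p → (App E T p s ↔ E x y)) ∧ (CEq E i k p → (App E T p s ↔ x = y))) ∧
    (∀ a p, IsFml E a → CNot E a p → (App E T p s ↔ ¬ App E T a s)) ∧
    (∀ a b p, IsFml E a → IsFml E b → CAnd E a b p →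
      (App E T p s ↔ App E T a s ∧ App E T b s)) ∧
    (∀ i a p, E i w → IsFml E a → CEx E i a p →
      (App E T p s ↔ ∃ x s', E x S ∧ IsMap E s' w S ∧ IsUpd E w s i x s' ∧ App E T a s'))

/-- `(S, ∈) ⊨ p[s]` -/
def Sat (S p s : M) : Prop := ∃ T, IsSatRel E S T ∧ App E T p s

/-- `k : (S, ∈) → (S, ∈)` is an elementary embedding (a set of the model): `S ⊨ p[s]` iff
`S ⊨ p[k ∘ s]` for all formulas `p` and all assignments `s`. -/
def IsElemMap (S k : M) : Prop :=
  IsMap E k S S ∧ ∀ w p s t, IsOmega E w → IsFml E p → IsMap E s w S → IsMap E t w S →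
    (∀ n x y, App E s n x → App E k x y → App E t n y) → (Sat E S p s ↔ Sat E S p t)

/-! ### Critical points, rank-Berkeley cardinals, Reinhardt cardinals

The graph of an embedding is given as a relation `F`, so that the same definitions apply to a
class `j : V → V` and to a set `k : V_α → V_α`. -/

/-- `κ = crit(F)`: the least ordinal moved by `F`, and `F(κ) > κ`. -/
def IsCrit (F : M → M → Prop) (κ : M) : Prop :=
  IsOrd E κ ∧ (∃ y, F κ y ∧ E κ y) ∧ ∀ β, E β κ → F β β

/-- `l = κ_ω(F) = sup_n κ_n`, where `κ_0 = crit(F)` and `κ_{n+1} = F(κ_n)`; the sequence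
`n ↦ κ_n` is `f`. -/
def IsKappaOmega (F : M → M → Prop) (l : M) : Prop :=
  ∃ κ w f, IsCrit E F κ ∧ IsOmega E w ∧ IsFunOn E f w ∧
    (∀ e, IsNum E 0 e → App E f e κ) ∧
    (∀ n m x, E n w → IsSucc E n m → App E f n x → ∃ y, F x y ∧ App E f m y) ∧
    ∀ z, E z l ↔ ∃ n x, E n w ∧ App E f n x ∧ E z x

/-- `δ` is rank-Berkeley: `δ > 0`, and for all ordinals `α ≥ δ` and `η < δ` there is an
elementary `k : V_α → V_α` with `crit(k) > η` and `κ_ω(k) = δ`. -/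
def IsRankBerkeley (δ : M) : Prop :=
  IsOrd E δ ∧ (∃ η, E η δ) ∧
    ∀ α η, IsOrd E α → (δ = α ∨ E δ α) → E η δ →
      ∃ S k κ, IsV E α S ∧ IsElemMap E S k ∧ IsCrit E (App E k) κ ∧ E η κ ∧
        IsKappaOmega E (App E k) δ

/-- `δ` is the least rank-Berkeley cardinal. -/
def IsLeastRankBerkeley (δ : M) : Prop :=
  IsRankBerkeley E δ ∧ ∀ δ', E δ' δ → ¬ IsRankBerkeley E δ'

/-- `(S, C) ⊨ ZF₂`: the sets are the members of `S`, the classes are the members of `C`, and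
Separation and Collection are required for all classes. -/
def ModelsZF2 (S C : M) : Prop :=
  ZFAxioms (fun x y : {x : M // E x S} => E x y)
    (fun P => ∃ A, E A C ∧ ∀ x, P x ↔ E x A)
    (fun R => ∃ A, E A C ∧ ∀ x y, R x y ↔ App E A x y)

/-- `(S, C) ⊨` "`κ` is a Reinhardt cardinal": the structure with sets `S` and classes `C` is a
model of `ZF₂`, and some class `k` is an elementary embedding of the universe `(S, ∈)` into
itself with critical point `κ`. -/
def ModelsReinhardt (S C κ : M) : Prop :=
  ModelsZF2 E S C ∧ ∃ k, E k C ∧ IsElemMap E S k ∧ IsCrit E (App E k) κ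

/-- `(V_γ, V_{γ+1}) ⊨` "`κ` is a Reinhardt cardinal" -/
def RankModelsReinhardt (γ κ : M) : Prop :=
  ∃ γ' S C, IsSucc E γ γ' ∧ IsV E γ S ∧ IsV E γ' C ∧ ModelsReinhardt E S C κ

/-- `X ∈ μ_j`, the measure over `κ` derived from `j`: `X ⊆ κ` and `κ ∈ j(X)`. -/
def InDerivedMeasure (j : M → M) (κ X : M) : Prop := IsSub E X κ ∧ E κ (j X)

end Notions

end Reinhardt

/-! Being the least rank-Berkeley ordinal is definable without parameters, so `j` fixes `δ`. If `κ_n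
≤ δ`, then `κ_{n+1} = j(κ_n) ≤ j(δ) = δ`; hence a fixed point below `κ_ω(j)` is below `κ`
(`IsKappaOmega.mem_of_fixed`). Rank-Berkeleyness at `α = κ` then yields an elementary `k : V_κ →
V_κ` with `κ_ω(k) = δ`, and `κ' = crit(k) < δ`. Without choice, `(V_κ, V_{κ+1}) ⊨ ZF₂` comes from
reflection: `j` fixes `V_κ` pointwise (`IsV.fixed`) and `V_κ ∈ j(V_κ)`, so any bound provided by
`V_κ` is also provided by an element of `V_κ` (`IsV.reflect`, `IsV.reflect₂`, `IsV.modelsZF2`). As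
`k ∈ V_{κ+1}`, `κ` itself has the property defining `X`. Since `j` fixes `κ' < κ`, elementarity
gives `κ ∈ j(X)`. Elementarity and Separation concern formulas; the class `Dfn` lets instance search
build these from the shape of a predicate. -/

namespace Reinhardt

open FirstOrder FirstOrder.Language

variable {M : Type u}

/-! ## Definable predicates -/

/-- `P` is definable without parameters in `(M, E)`; the arguments are the values of an
assignment of the variables. -/
class Dfn (E : M → M → Prop) (P : (ℕ → M) → Prop) : Prop where
  exists_formula : ∃ φ : LSet.Formula ℕ, ∀ v, P v ↔ @Formula.Realize LSet M (setStr E) ℕ φ v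

namespace Dfn

variable {E : M → M → Prop}

instance mem (a b : ℕ) : Dfn E fun v => E (v a) (v b) :=
  let _ := setStr E
  ⟨Relations.formula₂ (L := LSet) (MemRel.mem : LSet.Relations 2) (Term.var a) (Term.var b),
    fun v => (Formula.realize_rel₂ (L := LSet) (M := M) (v := v)
      (R := (MemRel.mem : LSet.Relations 2)) (t₁ := Term.var a) (t₂ := Term.var b)).symm⟩

instance eq (a b : ℕ) : Dfn E fun v => v a = v b :=
  let _ := setStr E
  ⟨Term.equal (Term.var a) (Term.var b), fun v => by rw [Formula.realize_equal]; rfl⟩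

instance imp (P Q : (ℕ → M) → Prop) [hP : Dfn E P] [hQ : Dfn E Q] :
    Dfn E fun v => P v → Q v := by
  let _ := setStr E
  obtain ⟨φ, hφ⟩ := hP
  obtain ⟨ψ, hψ⟩ := hQ
  exact ⟨φ.imp ψ, fun v => by rw [Formula.realize_imp, hφ, hψ]⟩

instance not (P : (ℕ → M) → Prop) [hP : Dfn E P] : Dfn E fun v => ¬ P v := by
  let _ := setStr E
  obtain ⟨φ, hφ⟩ := hP
  exact ⟨φ.not, fun v => by rw [Formula.realize_not, hφ]⟩

instance and (P Q : (ℕ → M) → Prop) [hP : Dfn E P] [hQ : Dfn E Q] :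
    Dfn E fun v => P v ∧ Q v := by
  let _ := setStr E
  obtain ⟨φ, hφ⟩ := hP
  obtain ⟨ψ, hψ⟩ := hQ
  exact ⟨φ ⊓ ψ, fun v => by rw [Formula.realize_inf, hφ, hψ]⟩

instance or (P Q : (ℕ → M) → Prop) [hP : Dfn E P] [hQ : Dfn E Q] :
    Dfn E fun v => P v ∨ Q v := by
  let _ := setStr E
  obtain ⟨φ, hφ⟩ := hP
  obtain ⟨ψ, hψ⟩ := hQ
  exact ⟨φ ⊔ ψ, fun v => by rw [Formula.realize_sup, hφ, hψ]⟩

instance iff (P Q : (ℕ → M) → Prop) [hP : Dfn E P] [hQ : Dfn E Q] :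
    Dfn E fun v => P v ↔ Q v := by
  let _ := setStr E
  obtain ⟨φ, hφ⟩ := hP
  obtain ⟨ψ, hψ⟩ := hQ
  exact ⟨φ.iff ψ, fun v => by rw [Formula.realize_iff, hφ, hψ]⟩

/-- The bound variable becomes variable 0 and the others shift up by one, so the body is again a
predicate of a single assignment. -/
instance all (Q : (ℕ → M) → M → Prop) [h : Dfn E fun v => Q (fun n => v (n + 1)) (v 0)] :
    Dfn E fun v => ∀ x, Q v x := by
  let _ := setStr E
  obtain ⟨φ, hφ⟩ := h
  let g : ℕ → ℕ ⊕ Fin 1 := fun n => Nat.casesOn n (Sum.inr 0) Sum.inl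
  refine ⟨Formula.iAlls (Fin 1) (φ.relabel g), fun v => ?_⟩
  rw [Formula.realize_iAlls]
  simp only [Formula.realize_relabel]
  refine ⟨fun H i => (hφ _).1 (H (i 0)), fun H x => (hφ fun n => Nat.casesOn n x v).2 ?_⟩
  convert H fun _ => x using 1
  funext n
  cases n <;> rfl

instance ex (Q : (ℕ → M) → M → Prop) [h : Dfn E fun v => Q (fun n => v (n + 1)) (v 0)] :
    Dfn E fun v => ∃ x, Q v x := by
  have := Dfn.not (E := E) (fun v => ∀ x, ¬ Q v x)
  simpa only [not_forall, not_not] using this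

instance existsUnique (Q : (ℕ → M) → M → Prop)
    [Dfn E fun v => ∃ x, Q v x ∧ ∀ y, Q v y → y = x] : Dfn E fun v => ∃! x, Q v x := ‹_›

theorem relabel (P : (ℕ → M) → Prop) [hP : Dfn E P] (g : ℕ → ℕ) :
    Dfn E fun v => P fun n => v (g n) := by
  let _ := setStr E
  obtain ⟨φ, hφ⟩ := hP
  exact ⟨Formula.relabel g φ, fun v => by rw [hφ, Formula.realize_relabel]; rfl⟩

end Dfn

/-! ### Definability of the set-theoretic notions -/

section Instances

variable {E : M → M → Prop}

instance (x y : ℕ) : Dfn E fun v => IsSub E (v x) (v y) := by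
  unfold IsSub; infer_instance

instance (x y : ℕ) : Dfn E fun v => IsSucc E (v x) (v y) := by
  unfold IsSucc; infer_instance

/-- The numeral is external: there is one formula for each `n`, built by induction in the
metatheory. -/
instance dfn_isNum (n x : ℕ) : Dfn E fun v => IsNum E n (v x) := by
  induction n generalizing x with
  | zero => unfold IsNum; infer_instance
  | succ n ih => unfold IsNum; infer_instance

instance (p x y : ℕ) : Dfn E fun v => IsOPair E (v p) (v x) (v y) := by
  unfold IsOPair; infer_instance

instance (f x y : ℕ) : Dfn E fun v => App E (v f) (v x) (v y) := by
  unfold App; infer_instance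

instance (f a : ℕ) : Dfn E fun v => IsFunOn E (v f) (v a) := by
  unfold IsFunOn; infer_instance

instance (f a b : ℕ) : Dfn E fun v => IsMap E (v f) (v a) (v b) := by
  unfold IsMap; infer_instance

instance (x : ℕ) : Dfn E fun v => IsOrd E (v x) := by
  unfold IsOrd; infer_instance

instance (w : ℕ) : Dfn E fun v => IsOmega E (v w) := by
  unfold IsOmega; infer_instance

instance (α x : ℕ) : Dfn E fun v => IsV E (v α) (v x) := by
  unfold IsV; infer_instance

instance (n a b p : ℕ) : Dfn E fun v => IsCode₂ E n (v a) (v b) (v p) := by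
  unfold IsCode₂; infer_instance

instance (a b p : ℕ) : Dfn E fun v => CMem E (v a) (v b) (v p) := by
  unfold CMem; infer_instance

instance (a b p : ℕ) : Dfn E fun v => CEq E (v a) (v b) (v p) := by
  unfold CEq; infer_instance

instance (a p : ℕ) : Dfn E fun v => CNot E (v a) (v p) := by
  unfold CNot; infer_instance

instance (a b p : ℕ) : Dfn E fun v => CAnd E (v a) (v b) (v p) := by
  unfold CAnd; infer_instance

instance (a b p : ℕ) : Dfn E fun v => CEx E (v a) (v b) (v p) := by
  unfold CEx; infer_instance

instance (p : ℕ) : Dfn E fun v => IsFml E (v p) := by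
  unfold IsFml; infer_instance

instance (w s i a s' : ℕ) : Dfn E fun v => IsUpd E (v w) (v s) (v i) (v a) (v s') := by
  unfold IsUpd; infer_instance

instance (S T : ℕ) : Dfn E fun v => IsSatRel E (v S) (v T) := by
  unfold IsSatRel; infer_instance

instance (S p s : ℕ) : Dfn E fun v => Sat E (v S) (v p) (v s) := by
  unfold Sat; infer_instance

instance (S k : ℕ) : Dfn E fun v => IsElemMap E (v S) (v k) := by
  unfold IsElemMap; infer_instance

instance (k κ : ℕ) : Dfn E fun v => IsCrit E (App E (v k)) (v κ) := by
  unfold IsCrit; infer_instance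

instance (k l : ℕ) : Dfn E fun v => IsKappaOmega E (App E (v k)) (v l) := by
  unfold IsKappaOmega; infer_instance

instance (δ : ℕ) : Dfn E fun v => IsRankBerkeley E (v δ) := by
  unfold IsRankBerkeley; infer_instance

instance (δ : ℕ) : Dfn E fun v => IsLeastRankBerkeley E (v δ) := by
  unfold IsLeastRankBerkeley; infer_instance

/-- `ModelsZF2` with all quantifiers ranging over the model. -/
theorem modelsZF2_iff (S C : M) : ModelsZF2 E S C ↔
    (∀ x, E x S → ∀ y, E y S → (∀ z, E z S → (E z x ↔ E z y)) → x = y) ∧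
    (∀ x, E x S → (∃ y, E y S ∧ E y x) →
      ∃ y, E y S ∧ E y x ∧ ∀ z, E z S → E z y → ¬ E z x) ∧
    (∀ x, E x S → ∀ y, E y S → ∃ z, E z S ∧ ∀ t, E t S → (E t z ↔ t = x ∨ t = y)) ∧
    (∀ x, E x S → ∃ z, E z S ∧ ∀ t, E t S → (E t z ↔ ∃ y, E y S ∧ E y x ∧ E t y)) ∧
    (∀ x, E x S → ∃ z, E z S ∧ ∀ t, E t S → (E t z ↔ ∀ s, E s S → E s t → E s x)) ∧
    (∃ x, E x S ∧ (∃ e, E e S ∧ (∀ z, E z S → ¬ E z e) ∧ E e x) ∧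
      ∀ y, E y S → E y x → ∃ z, E z S ∧ (∀ t, E t S → (E t z ↔ E t y ∨ t = y)) ∧ E z x) ∧
    (∀ A, E A C → ∀ a, E a S → ∃ b, E b S ∧ ∀ x, E x S → (E x b ↔ E x a ∧ E x A)) ∧
    (∀ A, E A C → ∀ a, E a S → (∀ x, E x S → E x a → ∃ y, E y S ∧ App E A x y) →
      ∃ b, E b S ∧ ∀ x, E x S → E x a → ∃ y, E y S ∧ E y b ∧ App E A x y) := by
  constructor
  · rintro ⟨h1, h2, h3, h4, h5, h6, h7, h8⟩
    -- The quantifiers over external predicates become quantifiers over the members `A` of `C` that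
    -- represent them.
    have h9 : ∀ A, E A C → _ := fun A hA => h7 (fun x => E x A) ⟨A, hA, fun _ => Iff.rfl⟩
    have h10 : ∀ A, E A C → _ := fun A hA =>
      h8 (fun x y => App E A x y) ⟨A, hA, fun _ _ => Iff.rfl⟩
    simp only [Subtype.forall, Subtype.exists, exists_prop, Subtype.mk.injEq]
      at h1 h2 h3 h4 h5 h6 h9 h10
    exact ⟨h1, h2, h3, h4, h5, h6, h9, h10⟩
  · rintro ⟨h1, h2, h3, h4, h5, h6, h7, h8⟩
    constructor
    case separation =>
      rintro P ⟨A, hA, hP⟩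
      simpa only [Subtype.forall, Subtype.exists, exists_prop, hP] using h7 A hA
    case collection =>
      rintro R ⟨A, hA, hR⟩
      simpa only [Subtype.forall, Subtype.exists, exists_prop, hR] using h8 A hA
    all_goals
      simpa only [Subtype.forall, Subtype.exists, exists_prop, Subtype.mk.injEq]

set_option synthInstance.maxSize 1000 in
set_option synthInstance.maxHeartbeats 200000 in
instance (S C : ℕ) : Dfn E fun v => ModelsZF2 E (v S) (v C) := by
  simp only [modelsZF2_iff]; infer_instance

instance (S C κ : ℕ) : Dfn E fun v => ModelsReinhardt E (v S) (v C) (v κ) := by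
  unfold ModelsReinhardt; infer_instance

instance (γ κ : ℕ) : Dfn E fun v => RankModelsReinhardt E (v γ) (v κ) := by
  unfold RankModelsReinhardt; infer_instance

end Instances

/-! ## Separation and elementarity for definable predicates -/

/-- The inclusion of the language of set theory in its expansion by a function symbol. -/
def lsetHom : LSet →ᴸ LSetJ := ⟨fun _ f => Empty.elim f, fun _ r => r⟩

section Separation

variable {E : M → M → Prop} {j : M → M}

theorem Dfn.exists_formulaJ (j : M → M) (P : (ℕ → M) → Prop) [h : Dfn E P] :
    ∃ φ : LSetJ.Formula ℕ, ∀ v, P v ↔ @Formula.Realize LSetJ M (setJStr E j) ℕ φ v := by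
  let _ := setStr E
  let _ := setJStr E j
  have : lsetHom.IsExpansionOn M := ⟨fun f => Empty.elim f, fun _ _ => rfl⟩
  obtain ⟨φ, hφ⟩ := h
  exact ⟨lsetHom.onFormula φ, fun v => by rw [hφ, LHom.realize_onFormula]⟩

theorem ModelsZFJ.separation (hZF : ModelsZFJ E j) (P : (ℕ → M) → Prop) [Dfn E P]
    (v : ℕ → M) (a : M) : ∃ b, ∀ x, E x b ↔ E x a ∧ P (Function.update v 0 x) := by
  obtain ⟨φ, hφ⟩ := Dfn.exists_formulaJ (E := E) j P
  exact ZFAxioms.separation hZF _ ⟨φ, v, fun x => hφ _⟩ a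

theorem ModelsZFJ.sep₁ (hZF : ModelsZFJ E j) (P : M → M → Prop)
    [Dfn E fun v => P (v 0) (v 1)] (a p : M) : ∃ b, ∀ x, E x b ↔ E x a ∧ P x p :=
  hZF.separation (fun v => P (v 0) (v 1)) (fun _ => p) a

theorem ModelsZFJ.sep₂ (hZF : ModelsZFJ E j) (P : M → M → M → Prop)
    [Dfn E fun v => P (v 0) (v 1) (v 2)] (a p q : M) : ∃ b, ∀ x, E x b ↔ E x a ∧ P x p q :=
  hZF.separation (fun v => P (v 0) (v 1) (v 2)) (fun n => if n = 1 then p else q) a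

/-- The points of a set that are moved by `j` form a set. -/
theorem ModelsZFJ.sep_moved (hZF : ModelsZFJ E j) (a : M) :
    ∃ b, ∀ x, E x b ↔ E x a ∧ j x ≠ x := by
  let _ := setJStr E j
  let t : LSetJ.Term ℕ := Term.func (EmbFun.emb : LSetJ.Functions 1) fun _ => Term.var 0
  refine ZFAxioms.separation hZF _ ⟨(Term.equal t (Term.var 0)).not, fun _ => a, fun x => ?_⟩ a
  rw [Formula.realize_not, Formula.realize_equal]
  rfl


theorem IsElementary.dfn (hj : IsElementary E j) (P : (ℕ → M) → Prop) [h : Dfn E P] (v : ℕ → M) :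
    P v ↔ P fun i => j (v i) := by
  obtain ⟨φ, hφ⟩ := h
  rw [hφ, hφ]
  exact hj φ v

theorem IsElementary.dfn₁ (hj : IsElementary E j) (P : M → Prop) [Dfn E fun v => P (v 0)]
    (a : M) : P a ↔ P (j a) :=
  hj.dfn (fun v => P (v 0)) fun _ => a

theorem IsElementary.dfn₂ (hj : IsElementary E j) (P : M → M → Prop)
    [Dfn E fun v => P (v 0) (v 1)] (a b : M) : P a b ↔ P (j a) (j b) :=
  hj.dfn (fun v => P (v 0) (v 1)) fun n => if n = 0 then a else b

theorem IsElementary.dfn₃ (hj : IsElementary E j) (P : M → M → M → Prop)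
    [Dfn E fun v => P (v 0) (v 1) (v 2)] (a b c : M) : P a b c ↔ P (j a) (j b) (j c) :=
  hj.dfn (fun v => P (v 0) (v 1) (v 2)) fun n => if n = 0 then a else if n = 1 then b else c

end Separation

/-! ## Elementary set theory in a model -/

section Basic

variable {E : M → M → Prop} {j : M → M}

theorem ModelsZFJ.ext (hZF : ModelsZFJ E j) {x y : M} (h : ∀ z, E z x ↔ E z y) : x = y :=
  ZFAxioms.extensionality hZF x y h

theorem ModelsZFJ.irrefl (hZF : ModelsZFJ E j) (x : M) : ¬ E x x := by
  obtain ⟨s, hs⟩ := ZFAxioms.pairing hZF x x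
  obtain ⟨y, hy, h⟩ := ZFAxioms.foundation hZF s ⟨x, (hs x).2 (.inl rfl)⟩
  obtain rfl : y = x := by simpa using (hs y).1 hy
  exact fun hyy => h y hyy hy

/-- A nonempty set has a minimal element. -/
theorem ModelsZFJ.exists_min (hZF : ModelsZFJ E j) {a : M} {Q : M → Prop}
    (hsep : ∃ b, ∀ x, E x b ↔ E x a ∧ Q x) (h : ∃ x, E x a ∧ Q x) :
    ∃ x, E x a ∧ Q x ∧ ∀ z, E z x → E z a → ¬ Q z := by
  obtain ⟨b, hb⟩ := hsep
  obtain ⟨x, hx⟩ := h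
  obtain ⟨y, hy, hmin⟩ := ZFAxioms.foundation hZF b ⟨x, (hb x).2 hx⟩
  exact ⟨y, ((hb y).1 hy).1, ((hb y).1 hy).2, fun z hzy hza hz => hmin z hzy ((hb z).2 ⟨hza, hz⟩)⟩

theorem ModelsZFJ.exists_succ (hZF : ModelsZFJ E j) (x : M) : ∃ y, IsSucc E x y := by
  obtain ⟨s, hs⟩ := ZFAxioms.pairing hZF x x
  obtain ⟨p, hp⟩ := ZFAxioms.pairing hZF x s
  obtain ⟨y, hy⟩ := ZFAxioms.union hZF p
  refine ⟨y, fun z => (hy z).trans ⟨?_, ?_⟩⟩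
  · rintro ⟨t, ht, hz⟩
    rcases (hp t).1 ht with rfl | rfl
    · exact .inl hz
    · exact .inr (by simpa using (hs z).1 hz)
  · rintro (h | rfl)
    · exact ⟨x, (hp x).2 (.inl rfl), h⟩
    · exact ⟨s, (hp s).2 (.inr rfl), (hs z).2 (.inl rfl)⟩

theorem IsOPair.inj (hZF : ModelsZFJ E j) {p x y x' y' : M} (h : IsOPair E p x y)
    (h' : IsOPair E p x' y') : x = x' ∧ y = y' := by
  obtain ⟨s, hs⟩ := ZFAxioms.pairing hZF x x
  obtain ⟨d, hd⟩ := ZFAxioms.pairing hZF x y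
  obtain ⟨d', hd'⟩ := ZFAxioms.pairing hZF x' y'
  have h1 := (h' s).1 ((h s).2 (.inl fun t => by simpa using hs t))
  have h2 := (h' d).1 ((h d).2 (.inr hd))
  have h3 := (h d').1 ((h' d').2 (.inr hd'))
  simp only [hs, hd, hd', or_self] at h1 h2 h3
  obtain rfl : x = x' := by
    rcases h1 with h1 | h1
    · exact (h1 x).1 rfl
    · exact ((h1 x').2 (.inl rfl)).symm
  refine ⟨rfl, ?_⟩
  rcases h2 with h2 | h2 <;> rcases h3 with h3 | h3 <;> have e2 := h2 y <;>
    have e3 := h3 y' <;> grind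

theorem IsFunOn.mem_of_app (hZF : ModelsZFJ E j) {f a x y : M} (hf : IsFunOn E f a)
    (h : App E f x y) : E x a := by
  obtain ⟨p, hp, hpf⟩ := h
  obtain ⟨x', y', hx', hp'⟩ := hf.1 p hpf
  rwa [(hp.inj hZF hp').1]

theorem IsFunOn.app_unique (hZF : ModelsZFJ E j) {f a x y y' : M} (hf : IsFunOn E f a)
    (h : App E f x y) (h' : App E f x y') : y = y' :=
  (hf.2 x (hf.mem_of_app hZF h)).unique h h'

/-! ### Ordinals -/

/-- A minimal element of `b ∖ a` has exactly the elements of `a`. -/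
theorem IsOrd.mem_of_ssub (hZF : ModelsZFJ E j) {a b : M} (ha : ∀ y, E y a → IsSub E y a)
    (hb : IsOrd E b) (hab : IsSub E a b) (hne : ∃ z, E z b ∧ ¬ E z a) : E a b := by
  obtain ⟨z, hzb, hza, hmin⟩ := hZF.exists_min (hZF.sep₁ (fun z a => ¬ E z a) b a) hne
  obtain rfl : z = a := hZF.ext fun t => by
    refine ⟨fun ht => by_contra fun hta => hmin t ht (hb.1 z hzb t ht) hta, fun ht => ?_⟩
    rcases hb.2 t z (hab t ht) hzb with h | rfl | h
    · exact h
    · exact absurd ht hza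
    · exact absurd (ha t ht z h) hza
  exact hzb

/-- If `c = a ∩ b` were a proper subset of both ordinals, it would belong to both, hence to itself.
-/
theorem IsOrd.trichotomy (hZF : ModelsZFJ E j) {a b : M} (ha : IsOrd E a) (hb : IsOrd E b) :
    E a b ∨ a = b ∨ E b a := by
  obtain ⟨c, hc⟩ := hZF.sep₁ (fun z b => E z b) a b
  have hct : ∀ y, E y c → IsSub E y c := fun y hy z hz =>
    (hc z).2 ⟨ha.1 y ((hc y).1 hy).1 z hz, hb.1 y ((hc y).1 hy).2 z hz⟩
  have hca : IsSub E c a := fun z hz => ((hc z).1 hz).1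
  have hcb : IsSub E c b := fun z hz => ((hc z).1 hz).2
  by_cases h1 : ∃ z, E z a ∧ ¬ E z c <;> by_cases h2 : ∃ z, E z b ∧ ¬ E z c
  · exact absurd ((hc c).2 ⟨ha.mem_of_ssub hZF hct hca h1, hb.mem_of_ssub hZF hct hcb h2⟩)
      (hZF.irrefl c)
  · push Not at h2
    obtain rfl : c = b := hZF.ext fun z => ⟨hcb z, h2 z⟩
    exact .inr (.inr (ha.mem_of_ssub hZF hct hca h1))
  · push Not at h1
    obtain rfl : c = a := hZF.ext fun z => ⟨hca z, h1 z⟩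
    exact .inl (hb.mem_of_ssub hZF hct hcb h2)
  · push Not at h1 h2
    exact .inr (.inl (hZF.ext fun z => ⟨fun h => hcb z (h1 z h), fun h => hca z (h2 z h)⟩))

theorem IsOrd.succ {a b : M} (ha : IsOrd E a) (hb : IsSucc E a b) : IsOrd E b := by
  refine ⟨fun y hy z hz => (hb z).2 (.inl ?_), fun y z hy hz => ?_⟩
  · rcases (hb y).1 hy with h | rfl
    · exact ha.1 y h z hz
    · exact hz
  · rcases (hb y).1 hy with h | rfl <;> rcases (hb z).1 hz with h' | rfl
    · exact ha.2 y z h h'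
    · exact .inl h
    · exact .inr (.inr h')
    · exact .inr (.inl rfl)

/-! ### The cumulative hierarchy -/

/-- `f` is the function `β ↦ V_β` with domain `α`. -/
def IsVFun (E : M → M → Prop) (f α : M) : Prop :=
  IsOrd E α ∧ IsFunOn E f α ∧
    ∀ β z, App E f β z → ∀ y, E y z ↔ ∃ γ u, E γ β ∧ App E f γ u ∧ IsSub E y u

instance (f α : ℕ) : Dfn E fun v => IsVFun E (v f) (v α) := by
  unfold IsVFun; infer_instance

/-- At a minimal `β` of disagreement the recursion forces equal values. The domains may differ,
which allows comparing a `V`-function with its image under `j`. -/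
theorem IsVFun.unique (hZF : ModelsZFJ E j) {f α f' α' : M} (hf : IsVFun E f α)
    (hf' : IsVFun E f' α') {β z z' : M} (hz : App E f β z) (hz' : App E f' β z') : z = z' := by
  by_contra hne
  obtain ⟨β, hβ, ⟨z, z', hz, hz', hne⟩, hmin⟩ := hZF.exists_min
    (hZF.sep₂ (fun β f f' => ∃ z z', App E f β z ∧ App E f' β z' ∧ z ≠ z') α f f')
    ⟨β, hf.2.1.mem_of_app hZF hz, z, z', hz, hz', hne⟩
  have hβ' := hf'.2.1.mem_of_app hZF hz'
  refine hne (hZF.ext fun y => ?_)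
  rw [hf.2.2 β z hz, hf'.2.2 β z' hz']
  constructor
  · rintro ⟨γ, u, hγ, hu, hy⟩
    obtain ⟨u', hu', -⟩ := hf'.2.1.2 γ (hf'.1.1 β hβ' γ hγ)
    have : u = u' := by_contra fun h => hmin γ hγ (hf.1.1 β hβ γ hγ) ⟨u, u', hu, hu', h⟩
    exact ⟨γ, u', hγ, hu', this ▸ hy⟩
  · rintro ⟨γ, u', hγ, hu', hy⟩
    obtain ⟨u, hu, -⟩ := hf.2.1.2 γ (hf.1.1 β hβ γ hγ)
    have : u = u' := by_contra fun h => hmin γ hγ (hf.1.1 β hβ γ hγ) ⟨u, u', hu, hu', h⟩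
    exact ⟨γ, u, hγ, hu, this ▸ hy⟩

/-- The values of a longer `V`-function at `α` are `V_α`. -/
theorem IsV.eq_of_app (hZF : ModelsZFJ E j) {α S f' α' z : M} (hS : IsV E α S)
    (hf' : IsVFun E f' α') (hz : App E f' α z) : z = S := by
  obtain ⟨hα, f, hf, hfV, hSf⟩ := hS
  have hV : IsVFun E f α := ⟨hα, hf, hfV⟩
  have hα' := hf'.2.1.mem_of_app hZF hz
  refine hZF.ext fun y => ?_
  rw [hf'.2.2 α z hz, hSf]
  constructor
  · rintro ⟨γ, u', hγ, hu', hy⟩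
    obtain ⟨u, hu, -⟩ := hf.2 γ hγ
    exact ⟨γ, u, hγ, hu, hV.unique hZF hf' hu hu' ▸ hy⟩
  · rintro ⟨γ, u, hγ, hu, hy⟩
    obtain ⟨u', hu', -⟩ := hf'.2.1.2 γ (hf'.1.1 α hα' γ hγ)
    exact ⟨γ, u', hγ, hu', hV.unique hZF hf' hu hu' ▸ hy⟩

/-- If `α < β`, then all subsets of `V_α` belong to `V_β`. -/
theorem IsV.mem_of_sub (hZF : ModelsZFJ E j) {α β S C y : M} (hS : IsV E α S) (hC : IsV E β C)
    (hαβ : E α β) (hy : IsSub E y S) : E y C := by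
  obtain ⟨hβ, f, hf, hfV, hCf⟩ := hC
  obtain ⟨z, hz, -⟩ := hf.2 α hαβ
  exact (hCf y).2 ⟨α, z, hαβ, hz, by rwa [hS.eq_of_app hZF ⟨hβ, hf, hfV⟩ hz]⟩

theorem IsV.sub_closed {α S x y : M} (hS : IsV E α S) (hx : E x S) (hyx : IsSub E y x) :
    E y S := by
  obtain ⟨hα, f, hf, hfV, hSf⟩ := hS
  obtain ⟨γ, u, hγ, hu, hxu⟩ := (hSf x).1 hx
  exact (hSf y).2 ⟨γ, u, hγ, hu, fun z hz => hxu z (hyx z hz)⟩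

theorem IsV.trans {α S : M} (hS : IsV E α S) {y z : M} (hy : E y S) (hz : E z y) : E z S := by
  obtain ⟨hα, f, hf, hfV, hSf⟩ := hS
  obtain ⟨γ, u, hγ, hu, hyu⟩ := (hSf y).1 hy
  obtain ⟨γ', u', hγ', hu', hzu⟩ := (hfV γ u hu z).1 (hyu z hz)
  exact (hSf z).2 ⟨γ', u', hα.1 γ hγ γ' hγ', hu', hzu⟩

end Basic

/-! ## The rank `V_κ` for a critical point `κ` -/

section Critical

variable {E : M → M → Prop} {j : M → M}

/-- `V_κ ∈ j(V_κ)` -/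
theorem IsV.mem_image (hZF : ModelsZFJ E j) (hj : IsElementary E j) {κ S : M}
    (hκ : IsCrit E (fun x y => j x = y) κ) (hS : IsV E κ S) : E S (j S) := by
  obtain ⟨-, ⟨_, rfl, h⟩, -⟩ := hκ
  exact hS.mem_of_sub hZF ((hj.dfn₂ (IsV E) κ S).1 hS) h fun _ => id

/-- `j` fixes all elements of `V_κ`. -/
theorem IsV.fixed (hZF : ModelsZFJ E j) (hj : IsElementary E j) {κ S x : M}
    (hκ : IsCrit E (fun x y => j x = y) κ) (hS : IsV E κ S) (hx : E x S) : j x = x := by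
  by_contra hne
  -- Here Separation is needed for a formula that mentions `j`.
  obtain ⟨D, hD⟩ := hZF.sep_moved S
  have htrans := fun y z => hS.trans (y := y) (z := z)
  obtain ⟨hα, f, hf, hfV, hSf⟩ := hS
  have hV : IsVFun E f κ := ⟨hα, hf, hfV⟩
  obtain ⟨γ₀, u₀, hγ₀, hu₀, hxu₀⟩ := (hSf x).1 hx
  -- Take `γ` minimal such that `u = V_γ` has a moved subset `x` in `V_κ`. Elements of `u` are
  -- subsets of earlier levels, hence fixed.
  obtain ⟨γ, hγ, ⟨u, x, hu, hxD, hxu⟩, hmin⟩ := hZF.exists_min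
    (hZF.sep₂ (fun γ f D => ∃ u x, App E f γ u ∧ E x D ∧ IsSub E x u) κ f D)
    ⟨γ₀, hγ₀, u₀, x, hu₀, (hD x).2 ⟨hx, hne⟩, hxu₀⟩
  have hfix : ∀ z, E z u → j z = z := by
    intro z hz
    obtain ⟨γ', u', hγ', hu', hzu⟩ := (hfV γ u hu z).1 hz
    have hγ'κ := hα.1 γ hγ γ' hγ'
    by_contra hjz
    exact hmin γ' hγ' hγ'κ
      ⟨u', z, hu', (hD z).2 ⟨(hSf z).2 ⟨γ', u', hγ'κ, hu', hzu⟩, hjz⟩, hzu⟩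
  -- `j(V_γ) = V_{j(γ)} = V_γ`, because `γ < κ`. So `j(x) ⊆ u`, and `x`, `j(x)` have the same
  -- elements.
  have hju : j u = u := by
    refine ((hj.dfn₂ (IsVFun E) f κ).1 hV).unique hZF hV ?_ hu
    have := (hj.dfn₃ (App E) f γ u).1 hu
    rwa [hκ.2.2 γ hγ] at this
  have hjx : IsSub E (j x) u := hju ▸ (hj.dfn₂ (IsSub E) x u).1 hxu
  refine ((hD x).1 hxD).2 (hZF.ext fun z => ⟨fun hz => ?_, fun hz => ?_⟩)
  · have hjz := hfix z (hjx z hz)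
    rw [← hjz] at hz
    exact (hj.dfn₂ E z x).2 hz
  · rw [← hfix z (hxu z hz)]
    exact (hj.dfn₂ E z x).1 hz

/-- A property of `V_κ` with a parameter fixed by `j` is shared by some element of `V_κ`. -/
theorem IsV.reflect (hZF : ModelsZFJ E j) (hj : IsElementary E j) {κ S : M}
    (hκ : IsCrit E (fun x y => j x = y) κ) (hS : IsV E κ S) (P : M → M → Prop)
    [Dfn E fun v => P (v 0) (v 1)] {a : M} (ha : j a = a) (h : P S a) :
    ∃ b, E b S ∧ P b a := by
  -- Under the quantifier, `b` is variable 0, `S` is 1 and `a` is 2.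
  have : Dfn E fun v => P (v 0) (v 2) :=
    Dfn.relabel (fun v => P (v 0) (v 1)) fun n => if n = 0 then 0 else 2
  rw [hj.dfn₂ (fun S a => ∃ b, E b S ∧ P b a) S a, ha]
  exact ⟨S, hS.mem_image hZF hj hκ, h⟩

/-- The second parameter need not be fixed: the hypothesis concerns `j c`, the conclusion `c`.
Collection needs this, with `c` a class that `j` may move. -/
theorem IsV.reflect₂ (hZF : ModelsZFJ E j) (hj : IsElementary E j) {κ S : M}
    (hκ : IsCrit E (fun x y => j x = y) κ) (hS : IsV E κ S) (P : M → M → M → Prop)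
    [Dfn E fun v => P (v 0) (v 1) (v 2)] {a c : M} (ha : j a = a) (h : P S a (j c)) :
    ∃ b, E b S ∧ P b a c := by
  have : Dfn E fun v => P (v 0) (v 2) (v 3) :=
    Dfn.relabel (fun v => P (v 0) (v 1) (v 2)) fun n => if n = 0 then 0 else n + 1
  rw [hj.dfn₃ (fun S a c => ∃ b, E b S ∧ P b a c) S a c, ha]
  exact ⟨S, hS.mem_image hZF hj hκ, h⟩

/-- `V_κ` contains both points, so some `b ∈ V_κ` does too; the pair is a subset of `b`. -/
theorem IsV.pair_mem (hZF : ModelsZFJ E j) (hj : IsElementary E j) {κ S x y z : M}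
    (hκ : IsCrit E (fun x y => j x = y) κ) (hS : IsV E κ S) (hx : E x S) (hy : E y S)
    (hz : ∀ t, E t z ↔ t = x ∨ t = y) : E z S := by
  obtain ⟨b, hb, hxb, hyb⟩ := hS.reflect₂ hZF hj hκ (fun b x y => E x b ∧ E y b)
    (a := x) (c := y) (hS.fixed hZF hj hκ hx) ⟨hx, by rwa [hS.fixed hZF hj hκ hy]⟩
  refine hS.sub_closed hb fun t ht => ?_
  rcases (hz t).1 ht with rfl | rfl
  · exact hxb
  · exact hyb

theorem IsV.opair_mem (hZF : ModelsZFJ E j) (hj : IsElementary E j) {κ S x y p : M}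
    (hκ : IsCrit E (fun x y => j x = y) κ) (hS : IsV E κ S) (hx : E x S) (hy : E y S)
    (hp : IsOPair E p x y) : E p S := by
  obtain ⟨s, hs⟩ := ZFAxioms.pairing hZF x x
  obtain ⟨d, hd⟩ := ZFAxioms.pairing hZF x y
  refine hS.pair_mem hZF hj hκ (hS.pair_mem hZF hj hκ hx hx hs)
    (hS.pair_mem hZF hj hκ hx hy hd)
    fun t => (hp t).trans (or_congr ⟨fun h => ?_, ?_⟩ ⟨fun h => ?_, ?_⟩)
  · exact hZF.ext fun z => by rw [h, hs, or_self]
  · rintro rfl z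
    rw [hs, or_self]
  · exact hZF.ext fun z => by rw [h, hd]
  · rintro rfl z
    rw [hd]

theorem IsV.succ_mem (hZF : ModelsZFJ E j) (hj : IsElementary E j) {κ S x y : M}
    (hκ : IsCrit E (fun x y => j x = y) κ) (hS : IsV E κ S) (hx : E x S)
    (hy : IsSucc E x y) : E y S := by
  obtain ⟨b, hb, hyb⟩ := hS.reflect hZF hj hκ (fun b x => IsSub E x b ∧ E x b)
    (hS.fixed hZF hj hκ hx) ⟨fun _ hz => hS.trans hx hz, hx⟩
  refine hS.sub_closed hb fun t ht => ?_
  rcases (hy t).1 ht with h | rfl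
  · exact hyb.1 t h
  · exact hyb.2

/-- `(V_κ, V_{κ+1})` is a model of second-order `ZF`. -/
theorem IsV.modelsZF2 (hZF : ModelsZFJ E j) (hj : IsElementary E j) {κ S : M}
    (hκ : IsCrit E (fun x y => j x = y) κ) (hS : IsV E κ S) (C : M) : ModelsZF2 E S C := by
  have hfix := fun x => hS.fixed (x := x) hZF hj hκ
  have htr := fun y hy z => hS.trans (y := y) (z := z) hy
  refine (modelsZF2_iff S C).2 ⟨?_, ?_, ?_, ?_, ?_, ?_, ?_, ?_⟩
  · exact fun x hx y hy h => hZF.ext fun z =>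
      ⟨fun hz => (h z (htr x hx z hz)).1 hz, fun hz => (h z (htr y hy z hz)).2 hz⟩
  · rintro x hx ⟨y, -, hy⟩
    obtain ⟨z, hz, h⟩ := ZFAxioms.foundation hZF x ⟨y, hy⟩
    exact ⟨z, htr x hx z hz, hz, fun t _ => h t⟩
  · intro x hx y hy
    obtain ⟨z, hz⟩ := ZFAxioms.pairing hZF x y
    exact ⟨z, hS.pair_mem hZF hj hκ hx hy hz, fun t _ => hz t⟩
  · intro x hx
    obtain ⟨z, hz⟩ := ZFAxioms.union hZF x
    obtain ⟨b, hb, h⟩ := hS.reflect hZF hj hκ (fun b x => ∀ y t, E y x → E t y → E t b)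
      (hfix x hx) fun y t hy ht => htr y (htr x hx y hy) t ht
    refine ⟨z, hS.sub_closed hb fun t ht => ?_, fun t _ => (hz t).trans
      ⟨fun ⟨y, hy, ht⟩ => ⟨y, htr x hx y hy, hy, ht⟩, fun ⟨y, _, hy, ht⟩ => ⟨y, hy, ht⟩⟩⟩
    obtain ⟨y, hy, hty⟩ := (hz t).1 ht
    exact h y t hy hty
  · intro x hx
    obtain ⟨z, hz⟩ := ZFAxioms.powerset hZF x
    obtain ⟨b, hb, h⟩ := hS.reflect hZF hj hκ (fun b x => ∀ y, IsSub E y x → E y b)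
      (hfix x hx) fun y hy => hS.sub_closed hx hy
    exact ⟨z, hS.sub_closed hb fun t ht => h t ((hz t).1 ht), fun t ht => (hz t).trans
      ⟨fun h s _ => h s, fun h s hs => h s (htr t ht s hs) hs⟩⟩
  · obtain ⟨-, ⟨_, rfl, hκj⟩, -⟩ := id hκ
    obtain ⟨w, ⟨e, he, -⟩, -⟩ := ZFAxioms.infinity hZF
    have heS : E e S := by
      obtain ⟨x, hx⟩ : ∃ x, E x S := by
        rw [hj.dfn₁ (fun S => ∃ x, E x S) S]
        exact ⟨S, hS.mem_image hZF hj hκ⟩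
      exact hS.sub_closed hx fun z hz => absurd hz (he z)
    -- `V_κ` is itself inductive, and this reflects to an element of it.
    obtain ⟨x, hx, ⟨e, he, hex⟩, h⟩ := hS.reflect hZF hj hκ (fun x _ =>
        (∃ e, (∀ z, ¬ E z e) ∧ E e x) ∧
        ∀ y, E y x → ∃ z, (∀ t, E t z ↔ E t y ∨ t = y) ∧ E z x) (hfix e heS)
      ⟨⟨e, he, heS⟩, fun y hy => by
        obtain ⟨z, hz⟩ := hZF.exists_succ y
        exact ⟨z, hz, hS.succ_mem hZF hj hκ hy hz⟩⟩
    refine ⟨x, hx, ⟨e, htr x hx e hex, fun z _ => he z, hex⟩, fun y _ hyx => ?_⟩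
    obtain ⟨z, hz, hzx⟩ := h y hyx
    exact ⟨z, htr x hx z hzx, fun t _ => hz t, hzx⟩
  · intro A _ a ha
    obtain ⟨b, hb⟩ := hZF.sep₁ (fun x A => E x A) a A
    exact ⟨b, hS.sub_closed ha fun x hx => ((hb x).1 hx).1, fun x _ => hb x⟩
  · intro A _ a ha h
    -- Witnesses in `V_κ` for `A` are also witnesses for `j(A)`, since `j` fixes both coordinates;
    -- so `V_κ` is a bound for `j(A)`.
    obtain ⟨b, hb, hab⟩ := hS.reflect₂ hZF hj hκ
      (fun b a A => ∀ x, E x a → ∃ y, E y b ∧ App E A x y) (a := a) (c := A) (hfix a ha)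
      fun x hx => by
        obtain ⟨y, hy, hxy⟩ := h x (htr a ha x hx) hx
        have := (hj.dfn₃ (App E) A x y).1 hxy
        rw [hfix x (htr a ha x hx), hfix y hy] at this
        exact ⟨y, hy, this⟩
    refine ⟨b, hb, fun x _ hx => ?_⟩
    obtain ⟨y, hy, hxy⟩ := hab x hx
    exact ⟨y, htr b hb y hy, hy, hxy⟩

end Critical

/-! ## Rank-Berkeley cardinals -/

section RankBerkeley

variable {E : M → M → Prop} {j : M → M}

/-- By elementarity `j δ` is also least rank-Berkeley, and two such ordinals are comparable. -/
theorem IsLeastRankBerkeley.fixed (hZF : ModelsZFJ E j) (hj : IsElementary E j) {δ : M}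
    (hδ : IsLeastRankBerkeley E δ) : j δ = δ := by
  have h := (hj.dfn₁ (IsLeastRankBerkeley E) δ).1 hδ
  rcases h.1.1.trichotomy hZF hδ.1.1 with h1 | h1 | h1
  · exact absurd h.1 (hδ.2 _ h1)
  · exact h1
  · exact absurd hδ.1 (h.2 _ h1)

theorem IsOmega.zero_mem {w e : M} (hw : IsOmega E w) (he : IsNum E 0 e) : E e w :=
  (hw e).2 fun _ h _ => h e he

theorem IsOmega.succ_mem {w n m : M} (hw : IsOmega E w) (hn : E n w) (hm : IsSucc E n m) :
    E m w :=
  (hw m).2 fun I h0 hs => hs n m ((hw n).1 hn I h0 hs) hm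

/-- A fixed point of `j` below `κ_ω(j)` lies below the critical point. -/
theorem IsKappaOmega.mem_of_fixed (hZF : ModelsZFJ E j) (hj : IsElementary E j) {κ l δ : M}
    (hκ : IsCrit E (fun x y => j x = y) κ) (hl : IsKappaOmega E (fun x y => j x = y) l)
    (hδl : E δ l) (hδ : j δ = δ) : E δ κ := by
  obtain ⟨κ₀, w, f, hκ₀, hw, hf, h0, hs, hlf⟩ := hl
  -- Critical points are unique: of two, the larger one's embedding clause would fix the smaller.
  obtain rfl : κ₀ = κ := by
    obtain ⟨-, ⟨_, rfl, h1⟩, -⟩ := id hκ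
    obtain ⟨-, ⟨_, rfl, h2⟩, -⟩ := id hκ₀
    rcases hκ₀.1.trichotomy hZF hκ.1 with h | h | h
    · rw [hκ.2.2 _ h] at h2
      exact absurd h2 (hZF.irrefl _)
    · exact h
    · rw [hκ₀.2.2 _ h] at h1
      exact absurd h1 (hZF.irrefl _)
  obtain ⟨n, x, hn, hx, hδx⟩ := (hlf δ).1 hδl
  by_contra hδκ
  -- `I = {n : δ ∉ κ_n}` is inductive, because `δ = j(δ) ∈ j(κ_n)` implies `δ ∈ κ_n`.
  obtain ⟨I, hI⟩ := hZF.sep₂ (fun n f δ => ∀ x, App E f n x → ¬ E δ x) w f δ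
  refine ((hI n).1 ((hw n).1 hn I (fun e he => ?_) fun n m hn hm => ?_)).2 x hx hδx
  · refine (hI e).2 ⟨hw.zero_mem he, fun x hx hδx => hδκ ?_⟩
    rwa [hf.app_unique hZF (h0 e he) hx]
  · obtain ⟨hnw, hnδ⟩ := (hI n).1 hn
    refine (hI m).2 ⟨hw.succ_mem hnw hm, fun x hx hδx => ?_⟩
    obtain ⟨y, hy, -⟩ := hf.2 n hnw
    obtain ⟨_, rfl, hjy⟩ := hs n m y hnw hm hy
    rw [hf.app_unique hZF hx hjy, ← hδ] at hδx
    exact hnδ y hy ((hj.dfn₂ E δ y).2 hδx)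

/-- `crit(k) < κ_ω(k)` -/
theorem IsKappaOmega.exists_crit_mem (hZF : ModelsZFJ E j) {S k l : M}
    (hl : IsKappaOmega E (App E k) l) (hk : IsFunOn E k S) :
    ∃ κ, IsCrit E (App E k) κ ∧ E κ l := by
  obtain ⟨κ, w, f, hκ, hw, hf, h0, hs, hlf⟩ := hl
  obtain ⟨-, ⟨e, he, -⟩, -⟩ := ZFAxioms.infinity hZF
  obtain ⟨m, hm⟩ := hZF.exists_succ e
  obtain ⟨y, hy, hmy⟩ := hs e m κ (hw.zero_mem he) hm (h0 e he)
  obtain ⟨y', hy', hκy'⟩ := hκ.2.1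
  refine ⟨κ, hκ, (hlf κ).2 ⟨m, y, hw.succ_mem (hw.zero_mem he) hm, hmy, ?_⟩⟩
  rwa [hk.app_unique hZF hy hy']

end RankBerkeley

end Reinhardt

open Reinhardt in
theorem theorem6p3 {M : Type u} (E : M → M → Prop) (j : M → M)
    (hZF : ModelsZFJ E j) (hj : IsElementary E j) (hne : ∃ x, j x ≠ x)
    (κ l δ : M)
    (hκ : IsCrit E (fun x y => j x = y) κ)
    (hl : IsKappaOmega E (fun x y => j x = y) l)
    (hδ : IsLeastRankBerkeley E δ) (hδl : E δ l) :
    E δ κ ∧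
      ∃ κ', E κ' δ ∧
        ∃ X, (∀ γ, E γ X ↔ E γ κ ∧ RankModelsReinhardt E γ κ') ∧
          InDerivedMeasure E j κ X := by
  have hδκ : E δ κ := hl.mem_of_fixed hZF hj hκ hδl (hδ.fixed hZF hj)
  obtain ⟨⟨-, ⟨η, hη⟩, hRB⟩, -⟩ := hδ
  obtain ⟨S, k, -, hS, hk, -, -, hkδ⟩ := hRB κ η hκ.1 (.inr hδκ) hη
  obtain ⟨κ₁, hκ₁⟩ := hZF.exists_succ κ
  -- This second use of rank-Berkeleyness only serves to supply the set `V_{κ+1}`.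
  obtain ⟨C, -, -, hC, -⟩ :=
    hRB κ₁ η (hκ.1.succ hκ₁) (.inr ((hκ₁ δ).2 (.inl hδκ))) hη
  obtain ⟨κ', hκ', hκ'δ⟩ := hkδ.exists_crit_mem hZF hk.1.1
  have hkC : E k C := by
    refine hS.mem_of_sub hZF hC ((hκ₁ κ).2 (.inr rfl)) fun p hp => ?_
    obtain ⟨x, y, hx, hpxy⟩ := hk.1.1.1 p hp
    exact hS.opair_mem hZF hj hκ hx (hk.1.2 x y ⟨p, hpxy, hp⟩) hpxy
  have hR : RankModelsReinhardt E κ κ' :=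
    ⟨κ₁, S, C, hκ₁, hS, hC, hS.modelsZF2 hZF hj hκ C, k, hkC, hk, hκ'⟩
  obtain ⟨X, hX⟩ := hZF.sep₁ (RankModelsReinhardt E) κ κ'
  refine ⟨hδκ, κ', hκ'δ, X, hX, fun γ hγ => ((hX γ).1 hγ).1, ?_⟩
  have hjX := (hj.dfn₃ (fun X κ κ' => ∀ γ, E γ X ↔ E γ κ ∧ RankModelsReinhardt E γ κ')
    X κ κ').1 hX
  -- `κ' < δ < κ` is fixed, so `j(X)` is defined by the same property with `κ` replaced by `j(κ)`.
  rw [hκ.2.2 κ' (hκ.1.1 δ hδκ κ' hκ'δ)] at hjX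
  obtain ⟨-, ⟨_, rfl, h⟩, -⟩ := hκ
  exact (hjX κ).2 ⟨h, hR⟩
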